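/- Let $\mathcal A$ be a finite non-empty alphabet, let $L>1$, and let $\varrho\colon\mathcal A\to\mathcal A^L$ be a substitution of constant length $L$, $\varrho(a)=\varrho_0(a)\varrho_1(a)\cdots\varrho_{L-1}(a)$, which is - *bijective*: every column $\varrho_j\colon\mathcal A\to\mathcal A$, $0\le j\le L-1$, is a permutation of $\mathcal A$; - *primitive*: there is $k\ge 1$ such that $\varrho^k(a)$ contains every letter of $\mathcal A$, for every $a\in\mathcal A$; - *aperiodic*: no element of the hull $\mathbb X_\varrho$ has a non-zero period. Here the hull $\mathbb X_\varrho\subseteq\mathcal A^{\mathbb Z}$ is the subshift of all $x\in\mathcal A^{\mathbb Z}$ every finite subword of which is a subword of some $\varrho^k(a)$, $k\ge1$, $a\in\mathcal A$; it carries the topology induced by the product topology (with $\mathcal A$ discrete) and the shift $(\sigma x)_n=x_{n+1}$. Let $\mathcal S(\mathbb X_\varrho)$ be the group of self-homeomorphisms of $\mathbb X_\varrho$ commuting with the shift action, and let $\mathcal R(\mathbb X_\varrho)$ be the group of self-homeomorphisms $H$ of $\mathbb X_\varrho$ with $H\circ\sigma\circ H^{-1}=\sigma$ or $H\circ\sigma\circ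 H^{-1}=\sigma^{-1}$. Suppose that $\varrho_i=\varrho_{L-(i+1)}=\mathrm{id}$ for some $0\le i\le L-1$. Let $\pi$ be a permutation of $\mathcal A$. Then the following are equivalent: (i) There is $f\in\mathcal R(\mathbb X_\varrho)\setminus\mathcal S(\mathbb X_\varrho)$ such that either $f(x)_n=\pi(x_{-n})$ for all $x\in\mathbb X_\varrho$ and $n\in\mathbb Z$, or $f(x)_n=\pi(x_{1-n})$ for all $x\in\mathbb X_\varrho$ and $n\in\mathbb Z$. (ii) $\pi^{-1}\circ\varrho_i\circ\pi=\varrho_{L-(i+1)}$ for all $0\le i\le L-1$. (iii) There are permutations $\kappa_0,\dots,\kappa_{L-1}$ of $\mathcal A$ with $\kappa_i^{-1}\circ\varrho_i\circ\kappa_i=\varrho_{L-(i+1)}$ for all $0\le i\le L-1$, such that the intersection of right cosets $$K=\bigcap_{i=0}^{L-1}\operatorname{cent}(\varrho_i)\,\kappa_i$$ is non-empty and $\pi\in K$, where $\operatorname{cent}(\varrho_i)$ is the centraliser of $\varrho_i$ in the symmetric group of $\mathcal A$. -/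

import Mathlib

open SymbolicDynamics.FullShift

namespace Subst

section Substitutions

variable {A : Type*} {L : ℕ}

/-- A substitution `A → A ^ L` of constant length `L`: the image of the letter `a` is the word
`ϱ a 0, ϱ a 1, …, ϱ a (L - 1)`. -/
abbrev ConstSubst (A : Type*) (L : ℕ) : Type _ := A → Fin L → A

/-- The extension of a substitution to finite words, by concatenation. -/
def onWord (ϱ : ConstSubst A L) (w : List A) : List A :=
  w.flatMap fun a => List.ofFn (ϱ a)

/-- The word `ϱ ^ k (a)`. -/
def iterWord (ϱ : ConstSubst A L) (k : ℕ) (a : A) : List A :=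
  (onWord ϱ)^[k] [a]

/-- Some power `ϱ ^ k` with `k ≥ 1` is such that `ϱ ^ k (a)` contains all letters, for every `a`. -/
def IsPrimitive (ϱ : ConstSubst A L) : Prop :=
  ∃ k : ℕ, 1 ≤ k ∧ ∀ a b : A, b ∈ iterWord ϱ k a

/-- Every column `a ↦ ϱ(a)_j` is a bijection of the alphabet. -/
def IsBijective (ϱ : ConstSubst A L) : Prop :=
  ∀ j : Fin L, Function.Bijective fun a => ϱ a j

/-- The `j`-th column of a bijective substitution, as a permutation of the alphabet. -/
noncomputable def column (ϱ : ConstSubst A L) (h : IsBijective ϱ) (j : Fin L) : Equiv.Perm A :=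
  Equiv.ofBijective (fun a => ϱ a j) (h j)

/-- The set of legal words: all subwords of the words `ϱ ^ k (a)`, `k ≥ 1`, `a ∈ A`. -/
def language (ϱ : ConstSubst A L) : Set (List A) :=
  {w | ∃ k : ℕ, 1 ≤ k ∧ ∃ a : A, w <:+: iterWord ϱ k a}

/-- The word of length `n` read in the configuration `x` from position `m` on. -/
def wordAt (x : ℤ → A) (m : ℤ) (n : ℕ) : List A :=
  List.ofFn fun i : Fin n => x (m + (i : ℕ))

/-- The configurations all of whose finite subwords are legal. -/
def hullSet (ϱ : ConstSubst A L) : Set (ℤ → A) :=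
  {x | ∀ (m : ℤ) (n : ℕ), wordAt x m n ∈ language ϱ}

theorem isClosed_hullSet [TopologicalSpace A] [DiscreteTopology A] (ϱ : ConstSubst A L) :
    IsClosed (hullSet ϱ) := by
  have h : hullSet ϱ = ⋂ (m : ℤ) (n : ℕ),
      (fun (x : ℤ → A) (i : Fin n) => x (m + (i : ℕ))) ⁻¹'
        {u : Fin n → A | List.ofFn u ∈ language ϱ} := by
    ext x
    simp [hullSet, wordAt]
  rw [h]
  refine isClosed_iInter fun m => isClosed_iInter fun n => IsClosed.preimage ?_ ?_
  · fun_prop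
  · exact isClosed_discrete _

/-- The substitutive subshift (hull) of `ϱ`. -/
def hull [TopologicalSpace A] [DiscreteTopology A] (ϱ : ConstSubst A L) : Subshift A ℤ where
  carrier := hullSet ϱ
  isClosed := isClosed_hullSet ϱ
  mapsTo g x hx m n := by
    have h := hx (g + m) n
    simpa [wordAt, add_assoc] using h

end Substitutions

section Symmetries

variable {A : Type*} [TopologicalSpace A]

/-- A subshift is aperiodic if none of its elements has a non-trivial period. -/
def IsAperiodic (X : Subshift A ℤ) : Prop :=
  ∀ x ∈ X.carrier, ∀ p : ℤ, p ≠ 0 → shift p x ≠ x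

/-- The shift map `(σ x)_n = x_{n+1}` as a self-homeomorphism of the subshift. -/
def sigma (X : Subshift A ℤ) : X.carrier ≃ₜ X.carrier where
  toFun x := ⟨shift 1 x.1, X.mapsTo 1 x.2⟩
  invFun x := ⟨shift (-1) x.1, X.mapsTo (-1) x.2⟩
  left_inv x := by ext n; simp [shift]
  right_inv x := by ext n; simp [shift]
  continuous_toFun :=
    ((continuous_shift (1 : ℤ)).comp continuous_subtype_val).subtype_mk _
  continuous_invFun :=
    ((continuous_shift (-1 : ℤ)).comp continuous_subtype_val).subtype_mk _

/-- The symmetry group: all self-homeomorphisms that commute with the shift action. The group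
operation on `X ≃ₜ X` is composition. -/
def symmetryGroup (X : Subshift A ℤ) : Subgroup (X.carrier ≃ₜ X.carrier) :=
  Subgroup.centralizer (Subgroup.zpowers (sigma X) : Set (X.carrier ≃ₜ X.carrier))

/-- The reversing symmetry group: all self-homeomorphisms `H` with `H ∘ σ ∘ H⁻¹ = σ` or
`H ∘ σ ∘ H⁻¹ = σ⁻¹`. -/
def reversingSymmetryGroup (X : Subshift A ℤ) : Subgroup (X.carrier ≃ₜ X.carrier) where
  carrier := {H | H * sigma X * H⁻¹ = sigma X ∨ H * sigma X * H⁻¹ = (sigma X)⁻¹}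
  one_mem' := by simp
  mul_mem' {a b} ha hb := by
    have key : a * b * sigma X * (a * b)⁻¹ = a * (b * sigma X * b⁻¹) * a⁻¹ := by group
    have inv : a * (sigma X)⁻¹ * a⁻¹ = (a * sigma X * a⁻¹)⁻¹ := by group
    simp only [Set.mem_ofPred_eq] at ha hb ⊢
    rw [key]
    rcases hb with hb | hb <;> rcases ha with ha | ha <;> simp [hb, inv, ha]
  inv_mem' {a} ha := by
    simp only [Set.mem_ofPred_eq] at ha ⊢
    rcases ha with ha | ha
    · left
      nth_rewrite 1 [← ha]
      group
    · right
      have h : sigma X = (a * sigma X * a⁻¹)⁻¹ := by rw [ha, inv_inv]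
      nth_rewrite 1 [h]
      group

end Symmetries

end Subst

open SymbolicDynamics.FullShift

namespace Subst

variable {A : Type*} {L : ℕ}

/-! The substance is that a reflection of the hull must respect the decomposition of configurations
into blocks `ϱ a`. Take `x` in the hull with a block `ϱ a` at position 0, and its image `z n = π (x
(e - n))`, again in the hull and hence cut into blocks (`exists_isCut`). Inside a block each letter
determines the next by a permutation depending only on the position modulo `L`; only block
boundaries can break this. If the cuts of `z` differed from the mirrored cuts of `x`, every boundary
of one cutting would be interior to the other, so each step of `z` would be such a permutation, and
finiteness of the symmetric group would make `z` periodic (`exists_period_of_step`).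

So the cuts agree (`isCut_of_reflection`), and the mirrored block `ϱ a` is a block `ϱ b` of `z`. The
column that is the identity together with its mirror forces `b = π a`; comparing the other columns
gives the conjugation relations. Conversely, these relations say that `ϱ` commutes with reversal
combined with `π`, so this operation preserves the language and the hull. The coset form holds
because conjugating a column by `γ * κ i`, with `γ` in its centraliser, is the same as conjugating
it by `κ i`. -/

/-! ### Words, lengths and the language. -/

theorem onWord_append (ϱ : ConstSubst A L) (v w : List A) :
    onWord ϱ (v ++ w) = onWord ϱ v ++ onWord ϱ w := by
  simp [onWord]

theorem length_onWord (ϱ : ConstSubst A L) (w : List A) :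
    (onWord ϱ w).length = L * w.length := by
  induction w with
  | nil => simp [onWord]
  | cons a w ih =>
    have h : onWord ϱ (a :: w) = List.ofFn (ϱ a) ++ onWord ϱ w := rfl
    rw [h, List.length_append, ih, List.length_ofFn, List.length_cons]
    ring

theorem getElem?_onWord (ϱ : ConstSubst A L) (w : List A) (m : ℕ) (j : Fin L) :
    (onWord ϱ w)[L * m + j]? = w[m]?.map fun a => ϱ a j := by
  induction w generalizing m with
  | nil => simp [onWord]
  | cons a w ih =>
    have h : onWord ϱ (a :: w) = List.ofFn (ϱ a) ++ onWord ϱ w := rfl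
    rw [h]
    cases m with
    | zero => simp [List.getElem?_append]
    | succ m =>
      rw [List.getElem?_append_right (by simp; nlinarith), List.length_ofFn,
        show L * (m + 1) + (j : ℕ) - L = L * m + j by
          rw [Nat.mul_succ]; omega, ih]
      simp

theorem onWord_infix (ϱ : ConstSubst A L) {v w : List A} (h : v <:+: w) :
    onWord ϱ v <:+: onWord ϱ w := by
  obtain ⟨s, t, rfl⟩ := h
  exact ⟨onWord ϱ s, onWord ϱ t, by simp [onWord_append]⟩

theorem iterate_onWord_append (ϱ : ConstSubst A L) (k : ℕ) (v w : List A) :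
    (onWord ϱ)^[k] (v ++ w) = (onWord ϱ)^[k] v ++ (onWord ϱ)^[k] w := by
  induction k generalizing v w with
  | zero => rfl
  | succ k ih => simp [onWord_append, ih]

theorem length_iterate_onWord (ϱ : ConstSubst A L) (k : ℕ) (w : List A) :
    ((onWord ϱ)^[k] w).length = L ^ k * w.length := by
  induction k generalizing w with
  | zero => simp
  | succ k ih => rw [Function.iterate_succ_apply, ih, length_onWord]; ring

theorem iterWord_succ (ϱ : ConstSubst A L) (k : ℕ) (a : A) :
    iterWord ϱ (k + 1) a = onWord ϱ (iterWord ϱ k a) :=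
  Function.iterate_succ_apply' _ _ _

theorem language_of_infix (ϱ : ConstSubst A L) {v w : List A} (h : v <:+: w)
    (hw : w ∈ language ϱ) : v ∈ language ϱ := by
  obtain ⟨k, hk, a, hwa⟩ := hw
  exact ⟨k, hk, a, h.trans hwa⟩

theorem onWord_mem_language (ϱ : ConstSubst A L) {w : List A} (hw : w ∈ language ϱ) :
    onWord ϱ w ∈ language ϱ := by
  obtain ⟨k, hk, a, hwa⟩ := hw
  exact ⟨k + 1, by omega, a, by rw [iterWord_succ]; exact onWord_infix ϱ hwa⟩

theorem length_wordAt (x : ℤ → A) (m : ℤ) (n : ℕ) : (wordAt x m n).length = n := by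
  simp [wordAt]

theorem getElem?_wordAt (x : ℤ → A) (m : ℤ) {n i : ℕ} (h : i < n) :
    (wordAt x m n)[i]? = some (x (m + i)) := by
  simp [wordAt, h]

theorem wordAt_add (x : ℤ → A) (m : ℤ) (n k : ℕ) :
    wordAt x m (n + k) = wordAt x m n ++ wordAt x (m + n) k := by
  simp [wordAt, List.ofFn_add, add_assoc]

theorem wordAt_infix (x : ℤ → A) {m m' : ℤ} {n n' : ℕ} (h : m' ≤ m) (h' : m + n ≤ m' + n') :
    wordAt x m n <:+: wordAt x m' n' := by
  obtain ⟨p, rfl⟩ := Int.le.dest h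
  obtain ⟨q, rfl⟩ : ∃ q : ℕ, n' = p + n + q := ⟨n' - (p + n), by omega⟩
  exact ⟨wordAt x m' p, wordAt x (m' + p + n) q, by simp [wordAt_add, add_assoc]⟩

/-! ### Every letter occurs in the hull. -/

/-- Supplies the wide margins around `a` needed for the compactness argument: an inner letter of `ϱ
^ 2 (b₀)` is inflated, and the inflated neighbours are the margins. -/
theorem exists_mem_language_getElem? [Nonempty A] (hL : 1 < L) (ϱ : ConstSubst A L)
    (hprim : IsPrimitive ϱ) (a : A) (n : ℕ) :
    ∃ u ∈ language ϱ, ∃ p : ℕ, n ≤ p ∧ p + n < u.length ∧ u[p]? = some a := by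
  -- Every exponent above `k` works as well: the image of the first letter of `ϱ b` already contains
  -- all letters.
  obtain ⟨k, hk, hmem⟩ := hprim
  have hmem' : ∀ (d : ℕ) (b c : A), c ∈ iterWord ϱ (k + d) b := by
    intro d
    induction d with
    | zero => exact hmem
    | succ d ih =>
      intro b c
      have hb : onWord ϱ [b] = List.ofFn (ϱ b) := by simp [onWord]
      have hsplit : List.ofFn (ϱ b) = (List.ofFn (ϱ b)).take 0 ++ [ϱ b ⟨0, by omega⟩] ++
          (List.ofFn (ϱ b)).drop 1 := by
        apply List.ext_getElem?
        intro i
        rcases i with _ | i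
        · simp; omega
        · simp
      rw [← add_assoc, iterWord, Function.iterate_succ_apply, hb, hsplit,
        iterate_onWord_append, iterate_onWord_append]
      exact List.mem_append_left _ (List.mem_append_right _ (ih _ _))
  obtain ⟨b₀⟩ := ‹Nonempty A›
  have hlen : (iterWord ϱ 2 b₀).length = L ^ 2 := by
    simp [iterWord, length_onWord, sq]
  obtain ⟨b, s, t, hst, hs, ht⟩ : ∃ b s t, iterWord ϱ 2 b₀ = s ++ [b] ++ t ∧
      1 ≤ s.length ∧ 1 ≤ t.length := by
    have h4 : 4 ≤ L ^ 2 := by nlinarith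
    generalize iterWord ϱ 2 b₀ = w at hlen
    match w, hlen with
    | [], h => simp at h; omega
    | [_], h => simp at h; omega
    | [_, _], h => simp at h; omega
    | c :: b :: d :: t, _ => exact ⟨b, [c], d :: t, rfl, by simp, by simp⟩
  -- `K ≥ k` puts `a` into `ϱ ^ K (b)`, and `K ≥ n` makes the margins, of length at least `L ^ K`,
  -- longer than `n`.
  set K := k + n
  have hn : n < L ^ K := (Nat.lt_pow_self hL).trans_le (Nat.pow_le_pow_right (by omega) (by omega))
  obtain ⟨s', t', hst'⟩ := List.append_of_mem (hmem' n b a)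
  have hword : iterWord ϱ (K + 2) b₀ =
      ((onWord ϱ)^[K] s ++ s') ++ a :: (t' ++ (onWord ϱ)^[K] t) := by
    have : iterWord ϱ (K + 2) b₀ = (onWord ϱ)^[K] (iterWord ϱ 2 b₀) :=
      Function.iterate_add_apply _ _ _ _
    rw [this, hst, iterate_onWord_append, iterate_onWord_append]
    change _ ++ iterWord ϱ K b ++ _ = _
    rw [hst']
    simp
  have hs' := length_iterate_onWord ϱ K s
  have ht' := length_iterate_onWord ϱ K t
  have hs2 : L ^ K ≤ L ^ K * s.length := Nat.le_mul_of_pos_right _ hs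
  have ht2 : L ^ K ≤ L ^ K * t.length := Nat.le_mul_of_pos_right _ ht
  refine ⟨iterWord ϱ (K + 2) b₀, ⟨K + 2, by omega, b₀, List.infix_rfl⟩,
    ((onWord ϱ)^[K] s ++ s').length, ?_, ?_, ?_⟩
  · rw [List.length_append]; omega
  · rw [hword]; simp only [List.length_append, List.length_cons]; omega
  · rw [hword]; simp

theorem exists_mem_hullSet_apply_zero [Finite A] [Nonempty A] (hL : 1 < L) (ϱ : ConstSubst A L)
    (hprim : IsPrimitive ϱ) (a : A) : ∃ x ∈ hullSet ϱ, x 0 = a := by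
  let _ : TopologicalSpace A := ⊥
  have : DiscreteTopology A := ⟨rfl⟩
  let C : ℕ → Set (ℤ → A) := fun n =>
    {x | x 0 = a ∧ wordAt x (-n) (2 * n + 1) ∈ language ϱ}
  have hclosed : ∀ n, IsClosed (C n) := by
    intro n
    have h : C n = (fun x : ℤ → A => x 0) ⁻¹' {a} ∩
        (fun (x : ℤ → A) (i : Fin (2 * n + 1)) => x (-n + (i : ℕ))) ⁻¹'
          {u | List.ofFn u ∈ language ϱ} := rfl
    rw [h]
    refine IsClosed.inter (IsClosed.preimage (by fun_prop) (isClosed_discrete _))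
      (IsClosed.preimage (by fun_prop) (isClosed_discrete _))
  have hne : ∀ n, (C n).Nonempty := by
    intro n
    obtain ⟨u, hu, p, hnp, hpn, hpa⟩ := exists_mem_language_getElem? hL ϱ hprim a n
    -- The word `u` is placed with its position `p` at the origin; values outside the central window
    -- are irrelevant.
    refine ⟨fun t => u.getD (p + t).toNat a, by simp [hpa], ?_⟩
    refine language_of_infix ϱ (w := u) ?_ hu
    have : wordAt (fun t : ℤ => u.getD (p + t).toNat a) (-n) (2 * n + 1) =
        (u.drop (p - n)).take (2 * n + 1) := by
      apply List.ext_getElem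
      · simp [length_wordAt]; omega
      · intro i h1 h2
        rw [length_wordAt] at h1
        have e : ((p : ℤ) + (-n + i)).toNat = p - n + i := by omega
        have hlt : p - n + i < u.length := by omega
        simp only [wordAt, List.getElem_ofFn, e, List.getElem_take, List.getElem_drop,
          List.getD_eq_getElem _ _ hlt]
    rw [this]
    exact (List.take_prefix _ _).isInfix.trans (List.drop_suffix _ _).isInfix
  have hmono : ∀ n, C (n + 1) ⊆ C n := fun n x hx =>
    ⟨hx.1, language_of_infix ϱ (wordAt_infix x (by push_cast; omega) (by push_cast; omega)) hx.2⟩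
  obtain ⟨x, hx⟩ := IsCompact.nonempty_iInter_of_sequence_nonempty_isCompact_isClosed C hmono hne
    (hclosed 0).isCompact hclosed
  rw [Set.mem_iInter] at hx
  refine ⟨x, fun m n => ?_, (hx 0).1⟩
  exact language_of_infix ϱ (wordAt_infix x (m' := -((m.natAbs + n : ℕ) : ℤ)) (by omega)
    (by omega)) (hx (m.natAbs + n)).2

/-! ### Cutting configurations into blocks. -/

/-- The configuration `x` is a concatenation of words `ϱ a`, one of which starts at `c`. -/
def IsCut (ϱ : ConstSubst A L) (x : ℤ → A) (c : ℤ) : Prop :=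
  ∀ p : ℤ, (L : ℤ) ∣ p - c → ∃ a, ∀ j : Fin L, x (p + (j : ℕ)) = ϱ a j

/-- Each finite window admits some cut residue. If all of the finitely many residues failed
globally, one window would contain a failure of each. -/
theorem exists_isCut (hL : 1 < L) (ϱ : ConstSubst A L) {x : ℤ → A} (hx : x ∈ hullSet ϱ) :
    ∃ c, IsCut ϱ x c := by
  have key : ∀ n : ℕ, ∃ r : Fin L, ∀ p : ℤ, (L : ℤ) ∣ p - (r : ℕ) → -(n : ℤ) ≤ p → p + L ≤ n →
      ∃ a, ∀ j : Fin L, x (p + (j : ℕ)) = ϱ a j := by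
    intro n
    obtain ⟨k, hk, a, s, t, hst⟩ := hx (-n) (2 * n + 1)
    obtain ⟨k, rfl⟩ : ∃ k', k = k' + 1 := ⟨k - 1, by omega⟩
    rw [iterWord_succ] at hst
    generalize iterWord ϱ k a = v at hst
    have hL0 : (L : ℤ) ≠ 0 := by omega
    have hr0 := Int.emod_nonneg (-(n : ℤ) - s.length) hL0
    have hr1 := Int.emod_lt_of_pos (-(n : ℤ) - s.length) (by omega : (0 : ℤ) < L)
    -- The window begins at `-n` and at index `s.length` of `onWord ϱ v`, so index 0 of that word
    -- sits at `-n - s.length`.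
    refine ⟨⟨((-(n : ℤ) - s.length) % L).toNat, by omega⟩, fun p hp hpn hpn' => ?_⟩
    have hdvd : (L : ℤ) ∣ p + n + s.length := by
      have h1 : (L : ℤ) ∣ (-(n : ℤ) - s.length) - (-(n : ℤ) - s.length) % L :=
        Int.dvd_self_sub_emod
      have h2 := dvd_sub hp h1
      rw [Int.toNat_of_nonneg hr0] at h2
      exact h2.trans (dvd_of_eq (by ring))
    obtain ⟨m, hm⟩ := hdvd
    have hm0 : 0 ≤ m := by
      by_contra hneg
      have : (L : ℤ) * m < 0 := mul_neg_of_pos_of_neg (by omega) (by omega)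
      omega
    lift m to ℕ using hm0
    have hget : ∀ j : Fin L, some (x (p + (j : ℕ))) = v[m]?.map fun a => ϱ a j := by
      intro j
      have hj := j.2
      have hmL : L * m = (p + n).toNat + s.length := by
        zify
        rw [← hm]; omega
      rw [← getElem?_onWord, ← hst, hmL, List.append_assoc, List.getElem?_append_right (by omega),
        List.getElem?_append_left (by rw [length_wordAt]; omega),
        getElem?_wordAt _ _ (by omega)]
      congr 2
      omega
    cases hv : v[m]? with
    | none => simpa [hv] using hget ⟨0, by omega⟩
    | some b => exact ⟨b, fun j => by simpa [hv] using hget j⟩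
  by_contra! hcon
  have hcon' : ∀ r : Fin L, ∃ n : ℕ, ∃ p : ℤ, (L : ℤ) ∣ p - (r : ℕ) ∧ -(n : ℤ) ≤ p ∧ p + L ≤ n ∧
      ¬ ∃ a, ∀ j : Fin L, x (p + (j : ℕ)) = ϱ a j := by
    intro r
    have := hcon (r : ℕ)
    unfold IsCut at this
    push Not at this
    obtain ⟨p, hp, h⟩ := this
    exact ⟨p.natAbs + L, p, hp, by omega, by omega, by push Not; exact h⟩
  choose n p h1 h2 h3 h4 using hcon'
  obtain ⟨r, hr⟩ := key (Finset.univ.sup n)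
  have hle : n r ≤ Finset.univ.sup n := Finset.le_sup (Finset.mem_univ r)
  have := h2 r
  have := h3 r
  exact h4 r (hr (p r) (h1 r) (by omega) (by omega))

/-- When `n + 1` is not the start of a block, `n` and `n + 1` are adjacent columns `q`, `q + 1` of
one block, so the step is column `q + 1` after the inverse of column `q`. -/
theorem IsCut.exists_perm (hL : 1 < L) {ϱ : ConstSubst A L} (hbij : IsBijective ϱ) {x : ℤ → A}
    {c : ℤ} (hx : IsCut ϱ x c) {r : ℤ} (hr : ¬ (L : ℤ) ∣ r + 1 - c) :
    ∃ g : Equiv.Perm A, ∀ n : ℤ, (L : ℤ) ∣ n - r → x (n + 1) = g (x n) := by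
  have hL0 : (L : ℤ) ≠ 0 := by omega
  have hr0 := Int.emod_nonneg (r - c) hL0
  have hr1 := Int.emod_lt_of_pos (r - c) (by omega : (0 : ℤ) < L)
  have hd : (L : ℤ) ∣ (r - c) - (r - c) % L := Int.dvd_self_sub_emod
  set q := (r - c) % L
  have hq : q + 1 < L := by
    by_contra hge
    apply hr
    have h := dvd_add hd (dvd_refl (L : ℤ))
    exact h.trans (dvd_of_eq (by omega))
  refine ⟨column ϱ hbij ⟨(q + 1).toNat, by omega⟩ * (column ϱ hbij ⟨q.toNat, by omega⟩)⁻¹,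
    fun n hn => ?_⟩
  obtain ⟨a, ha⟩ := hx (n - q) ((dvd_add hn hd).trans (dvd_of_eq (by ring)))
  have h0 := ha ⟨q.toNat, by omega⟩
  have h1 := ha ⟨(q + 1).toNat, by omega⟩
  simp only [Int.toNat_of_nonneg hr0, Int.toNat_of_nonneg (show 0 ≤ q + 1 by omega)] at h0 h1
  rw [sub_add_cancel] at h0
  rw [show n - q + (q + 1) = n + 1 by ring] at h1
  have h2 : column ϱ hbij ⟨q.toNat, by omega⟩ a = x n := h0.symm
  rw [h1, Equiv.Perm.mul_apply, ← h2, Equiv.Perm.inv_def, Equiv.symm_apply_apply]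
  rfl

/-- Composing `L` steps returns to the same residue class, so one permutation per class gives the
shift by `L`; its power by the order of the symmetric group is trivial. -/
theorem exists_period_of_step [Finite A] (hL : L ≠ 0) {z : ℤ → A}
    (h : ∀ r : ℤ, ∃ g : Equiv.Perm A, ∀ n : ℤ, (L : ℤ) ∣ n - r → z (n + 1) = g (z n)) :
    ∃ p : ℤ, p ≠ 0 ∧ shift p z = z := by
  have hk : ∀ (k : ℕ) (r : ℤ), ∃ g : Equiv.Perm A, ∀ n : ℤ, (L : ℤ) ∣ n - r →
      z (n + k) = g (z n) := by
    intro k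
    induction k with
    | zero => exact fun r => ⟨1, fun n _ => by simp⟩
    | succ k ih =>
      intro r
      obtain ⟨g, hg⟩ := ih r
      obtain ⟨g', hg'⟩ := h (r + k)
      refine ⟨g' * g, fun n hn => ?_⟩
      rw [Equiv.Perm.mul_apply, ← hg n hn, ← hg' (n + k) (hn.trans (dvd_of_eq (by ring)))]
      push_cast
      rw [add_assoc]
  refine ⟨L * (Nat.card (Equiv.Perm A) : ℕ), ?_, ?_⟩
  · have : Nat.card (Equiv.Perm A) ≠ 0 := Nat.card_pos.ne'
    positivity
  · funext n
    obtain ⟨g, hg⟩ := hk L n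
    have ht : ∀ t : ℕ, z (n + L * t) = (g ^ t) (z n) := by
      intro t
      induction t with
      | zero => simp
      | succ t ih =>
        rw [pow_succ', Equiv.Perm.mul_apply, ← ih, ← hg _ (by simp)]
        push_cast
        congr 1
        ring
    have := ht (Nat.card (Equiv.Perm A))
    rw [pow_card_eq_one'] at this
    simpa [shift, add_comm] using this

/-- The mirror of a block of `x` on `[0, L - 1]` occupies `[e + 1 - L, e]`, so mirrored cuts are
congruent to `e + 1` modulo `L`. -/
theorem isCut_of_reflection [Finite A] (hL : 1 < L) {ϱ : ConstSubst A L} (hbij : IsBijective ϱ)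
    (π : Equiv.Perm A) {x z : ℤ → A} {c e : ℤ} (hx : IsCut ϱ x 0) (hz : IsCut ϱ z c)
    (hxz : ∀ n, z n = π (x (e - n))) (haper : ∀ p : ℤ, p ≠ 0 → shift p z ≠ z) :
    (L : ℤ) ∣ e + 1 - c := by
  by_contra hnd
  obtain ⟨p, hp, hpz⟩ := exists_period_of_step (L := L) (by omega) (z := z) fun r => by
    -- At a boundary of `z` the mirrored step is interior to a block of `x`; it runs backwards,
    -- whence `g⁻¹`, conjugated by `π`.
    by_cases hr : (L : ℤ) ∣ r + 1 - c
    · have hr' : ¬ (L : ℤ) ∣ (e - r - 1) + 1 - 0 := fun h => hnd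
        ((dvd_add hr h).trans (dvd_of_eq (by ring)))
      obtain ⟨g, hg⟩ := hx.exists_perm hL hbij hr'
      refine ⟨π * g⁻¹ * π⁻¹, fun n hn => ?_⟩
      have := hg (e - n - 1) ((dvd_neg.2 hn).trans (dvd_of_eq (by ring)))
      rw [sub_add_cancel] at this
      rw [hxz, hxz, this]
      simp [sub_sub]
    · exact hz.exists_perm hL hbij hr
  exact haper p hp hpz

/-- The configuration is `ϱ y`, for `y` in the hull with `y 0 = a`. -/
theorem exists_mem_hullSet_isCut [Finite A] [Nonempty A] (hL : 1 < L) (ϱ : ConstSubst A L)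
    (hprim : IsPrimitive ϱ) (a : A) :
    ∃ x ∈ hullSet ϱ, IsCut ϱ x 0 ∧ ∀ j : Fin L, x (j : ℕ) = ϱ a j := by
  obtain ⟨y, hy, hya⟩ := exists_mem_hullSet_apply_zero hL ϱ hprim a
  have hLpos : (0 : ℤ) < L := by omega
  let x : ℤ → A := fun n => ϱ (y (n / L)) ⟨(n % L).toNat, by
    have := Int.emod_nonneg n hLpos.ne'
    have := Int.emod_lt_of_pos n hLpos
    omega⟩
  have hxy : ∀ (m : ℤ) (j : Fin L), x (L * m + (j : ℕ)) = ϱ (y m) j := by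
    intro m j
    have hj := j.2
    have h1 : ((L : ℤ) * m + (j : ℕ)) / L = m := by
      rw [Int.mul_add_ediv_left _ _ hLpos.ne', Int.ediv_eq_zero_of_lt (by omega) (by omega),
        add_zero]
    have h2 : ((L : ℤ) * m + (j : ℕ)) % L = (j : ℕ) := by
      rw [Int.mul_add_emod_self_left, Int.emod_eq_of_lt (by omega) (by omega)]
    simp only [x, h1, h2]
    rfl
  have hblock : ∀ (m : ℤ) (n : ℕ), wordAt x (L * m) (L * n) = onWord ϱ (wordAt y m n) := by
    intro m n
    induction n with
    | zero => simp [wordAt, onWord]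
    | succ n ih =>
      rw [Nat.mul_succ, wordAt_add, ih, wordAt_add, onWord_append]
      congr 1
      have : (L : ℤ) * m + ((L * n : ℕ) : ℤ) = L * (m + n) := by push_cast; ring
      rw [this]
      simp [wordAt, onWord, hxy]
  refine ⟨x, fun m n => ?_, ?_, ?_⟩
  · have hd := Int.mul_ediv_add_emod m L
    have h0 := Int.emod_nonneg m hLpos.ne'
    have h1 := Int.emod_lt_of_pos m hLpos
    refine language_of_infix ϱ (wordAt_infix x (m' := L * (m / L)) (n' := L * (n + 1))
      (by omega) ?_) (by rw [hblock]; exact onWord_mem_language ϱ (hy _ _))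
    push_cast
    nlinarith
  · rintro p ⟨m, hm⟩
    exact ⟨y m, fun j => by rw [← hxy, ← hm, sub_zero]⟩
  · intro j
    rw [← hya, ← hxy]
    simp

theorem conj_column_of_reflection [Finite A] [Nonempty A] (hL : 1 < L) {ϱ : ConstSubst A L}
    (haper : ∀ x ∈ hullSet ϱ, ∀ p : ℤ, p ≠ 0 → shift p x ≠ x) (hprim : IsPrimitive ϱ)
    (hbij : IsBijective ϱ) (hid : ∃ i : Fin L, column ϱ hbij i = 1 ∧ column ϱ hbij i.rev = 1)
    (π : Equiv.Perm A) (e : ℤ) (hf : ∀ x ∈ hullSet ϱ, (fun n => π (x (e - n))) ∈ hullSet ϱ)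
    (i : Fin L) : π⁻¹ * column ϱ hbij i * π = column ϱ hbij i.rev := by
  ext a
  obtain ⟨x, hx, hcut, hxa⟩ := exists_mem_hullSet_isCut hL ϱ hprim a
  obtain ⟨c, hc⟩ := exists_isCut hL ϱ (hf x hx)
  have hdvd := isCut_of_reflection hL hbij π hcut hc (fun _ => rfl) (haper _ (hf x hx))
  obtain ⟨b, hb⟩ := hc (e + 1 - L) 
    ((dvd_sub hdvd (dvd_refl (L : ℤ))).trans (dvd_of_eq (by ring)))
  have hab : ∀ j : Fin L, π (column ϱ hbij j.rev a) = column ϱ hbij j b := by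
    intro j
    have hj := j.2
    have h1 : e - (e + 1 - L + (j : ℕ)) = (j.rev : ℕ) := by
      rw [Fin.val_rev]; omega
    have h2 := hb j
    simp only [h1, hxa] at h2
    exact h2
  obtain ⟨k, hk, hk'⟩ := hid
  -- Both column `k` and its mirror are needed: one acts on `a`, the other on `b`.
  have hπ : π a = b := by simpa [hk, hk'] using hab k
  rw [Equiv.Perm.mul_apply, Equiv.Perm.mul_apply, hπ, ← hab, Equiv.Perm.inv_def, Equiv.symm_apply_apply]

/-! ### Constructing the reflection. -/

theorem reverse_ofFn {n : ℕ} (u : Fin n → A) :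
    (List.ofFn u).reverse = List.ofFn fun i => u i.rev := by
  apply List.ext_getElem
  · simp
  · intro i h1 h2
    simp only [List.getElem_reverse, List.getElem_ofFn, List.length_ofFn]
    congr 1
    ext
    simp only [Fin.val_rev]
    omega

theorem reflection_mem_language {ϱ : ConstSubst A L} {π : Equiv.Perm A}
    (h : ∀ (a : A) (j : Fin L), ϱ (π a) j = π (ϱ a j.rev)) {w : List A} (hw : w ∈ language ϱ) :
    (w.map π).reverse ∈ language ϱ := by
  have hblock : ∀ a, List.ofFn (ϱ (π a)) = ((List.ofFn (ϱ a)).map π).reverse := by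
    intro a
    rw [List.map_ofFn, reverse_ofFn]
    congr 1
    funext j
    exact h a j
  have hon : ∀ v : List A, onWord ϱ (v.map π).reverse = ((onWord ϱ v).map π).reverse := by
    intro v
    induction v with
    | nil => simp [onWord]
    | cons a v ih =>
      have h1 : onWord ϱ (a :: v) = List.ofFn (ϱ a) ++ onWord ϱ v := rfl
      have h2 : onWord ϱ [π a] = List.ofFn (ϱ (π a)) := by simp [onWord]
      rw [h1, List.map_cons, List.reverse_cons, onWord_append, ih, h2, hblock, List.map_append,
        List.reverse_append]
  have hiter : ∀ (k : ℕ) (a : A), iterWord ϱ k (π a) = ((iterWord ϱ k a).map π).reverse := by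
    intro k a
    induction k with
    | zero => rfl
    | succ k ih => rw [iterWord_succ, ih, hon, iterWord_succ]
  obtain ⟨k, hk, a, hwa⟩ := hw
  exact ⟨k, hk, π a, by rw [hiter]; exact (List.reverse_infix.2 (hwa.map π))⟩

theorem reflection_mem_hullSet {ϱ : ConstSubst A L} {π : Equiv.Perm A}
    (h : ∀ (a : A) (j : Fin L), ϱ (π a) j = π (ϱ a j.rev)) {x : ℤ → A} (hx : x ∈ hullSet ϱ) :
    (fun n => π (x (-n))) ∈ hullSet ϱ := by
  intro m n
  -- The mirror image of the window `[m, m + n - 1]` starts at `-m - n + 1`.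
  have := reflection_mem_language h (hx (-m - n + 1) n)
  convert this using 1
  rw [wordAt, wordAt, List.map_ofFn, reverse_ofFn]
  congr 1
  funext j
  have hj := j.2
  simp only [Function.comp_apply, Fin.val_rev]
  congr 2
  omega

/-- The self-homeomorphism `x ↦ (π (x (-n)))_n` of the hull. -/
def reflection [TopologicalSpace A] [DiscreteTopology A] (ϱ : ConstSubst A L) (π : Equiv.Perm A)
    (h : ∀ (a : A) (j : Fin L), ϱ (π a) j = π (ϱ a j.rev))
    (h' : ∀ (a : A) (j : Fin L), ϱ (π⁻¹ a) j = π⁻¹ (ϱ a j.rev)) :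
    (hull ϱ).carrier ≃ₜ (hull ϱ).carrier where
  toFun x := ⟨fun n => π (x.1 (-n)), reflection_mem_hullSet h x.2⟩
  invFun x := ⟨fun n => π⁻¹ (x.1 (-n)), reflection_mem_hullSet h' x.2⟩
  left_inv x := by ext n; simp
  right_inv x := by ext n; simp
  continuous_toFun := by
    refine Continuous.subtype_mk (continuous_pi fun n => ?_) _
    exact continuous_of_discreteTopology.comp
      ((continuous_apply (-n)).comp continuous_subtype_val)
  continuous_invFun := by
    refine Continuous.subtype_mk (continuous_pi fun n => ?_) _
    exact continuous_of_discreteTopology.comp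
      ((continuous_apply (-n)).comp continuous_subtype_val)

theorem exists_reflection [Finite A] [Nonempty A] [TopologicalSpace A] [DiscreteTopology A]
    (hL : 1 < L) (ϱ : ConstSubst A L) (haper : IsAperiodic (hull ϱ)) (hprim : IsPrimitive ϱ)
    (hbij : IsBijective ϱ) (π : Equiv.Perm A)
    (hπ : ∀ i : Fin L, π⁻¹ * column ϱ hbij i * π = column ϱ hbij i.rev) :
    ∃ f : (hull ϱ).carrier ≃ₜ (hull ϱ).carrier, f ∈ reversingSymmetryGroup (hull ϱ) ∧
      f ∉ symmetryGroup (hull ϱ) ∧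
      ∀ (x : (hull ϱ).carrier) (n : ℤ), (f x).1 n = π (x.1 (-n)) := by
  have h : ∀ (a : A) (j : Fin L), ϱ (π a) j = π (ϱ a j.rev) := fun a j => by
    have := DFunLike.congr_fun (hπ j) a
    rw [Equiv.Perm.mul_apply, Equiv.Perm.mul_apply, Equiv.Perm.inv_eq_iff_eq] at this
    exact this
  -- Reversing columns is an involution, so the relation passes to `π⁻¹`.
  have h' : ∀ (a : A) (j : Fin L), ϱ (π⁻¹ a) j = π⁻¹ (ϱ a j.rev) := fun a j => by
    have := h (π⁻¹ a) j.rev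
    rw [Equiv.Perm.inv_def, Equiv.apply_symm_apply, Fin.rev_rev] at this
    rw [this, Equiv.Perm.inv_def, Equiv.symm_apply_apply]
  set f := reflection ϱ π h h'
  have hf : ∀ (x : (hull ϱ).carrier) (n : ℤ), (f x).1 n = π (x.1 (-n)) := fun _ _ => rfl
  have hrev : f * sigma (hull ϱ) = (sigma (hull ϱ))⁻¹ * f := by
    ext x n
    change π (x.1 (1 + -n)) = π (x.1 (-(-1 + n)))
    rw [show 1 + -n = -(-1 + n) by ring]
  refine ⟨f, Or.inr (by rw [hrev, mul_inv_cancel_right]), fun hmem => ?_, hf⟩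
  have hcomm : sigma (hull ϱ) * f = f * sigma (hull ϱ) :=
    Subgroup.mem_centralizer_iff.1 hmem _ (Subgroup.mem_zpowers _)
  rw [hrev] at hcomm
  -- Commuting with `σ` as well as reversing it would give `σ = σ⁻¹`, hence the forbidden period 2.
  have hs := mul_right_cancel hcomm
  obtain ⟨a⟩ := ‹Nonempty A›
  obtain ⟨x, hx, -⟩ := exists_mem_hullSet_apply_zero hL ϱ hprim a
  refine haper x hx 2 two_ne_zero (funext fun n => ?_)
  have h1 := congrFun (congrArg Subtype.val (DFunLike.congr_fun hs ⟨x, hx⟩)) (n + 1)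
  change x (1 + (n + 1)) = x (-1 + (n + 1)) at h1
  rw [show (1 : ℤ) + (n + 1) = 2 + n by ring, show (-1 : ℤ) + (n + 1) = n by ring] at h1
  exact h1

end Subst

/-! ### Centraliser cosets and the equivalences. -/

theorem conj_eq_of_commute_mul {G : Type*} [Group G] {a γ κ : G} (h : a * γ = γ * a) :
    (γ * κ)⁻¹ * a * (γ * κ) = κ⁻¹ * a * κ := by
  rw [mul_inv_rev, mul_assoc, ← mul_assoc a, h]
  group

theorem mainTheorem2 {A : Type*} [Finite A] [Nonempty A] [TopologicalSpace A] [DiscreteTopology A]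
    {L : ℕ} (hL : 1 < L) (ϱ : Subst.ConstSubst A L)
    (haper : Subst.IsAperiodic (Subst.hull ϱ))
    (hprim : Subst.IsPrimitive ϱ)
    (hbij : Subst.IsBijective ϱ)
    (hid : ∃ i : Fin L, Subst.column ϱ hbij i = 1 ∧ Subst.column ϱ hbij i.rev = 1)
    (π : Equiv.Perm A) :
    List.TFAE [
      ∃ f : (Subst.hull ϱ).carrier ≃ₜ (Subst.hull ϱ).carrier,
        f ∈ Subst.reversingSymmetryGroup (Subst.hull ϱ) ∧
        f ∉ Subst.symmetryGroup (Subst.hull ϱ) ∧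
        ((∀ (x : (Subst.hull ϱ).carrier) (n : ℤ), (f x).1 n = π (x.1 (-n))) ∨
          (∀ (x : (Subst.hull ϱ).carrier) (n : ℤ), (f x).1 n = π (x.1 (1 - n)))),
      ∀ i : Fin L, π⁻¹ * Subst.column ϱ hbij i * π = Subst.column ϱ hbij i.rev,
      ∃ κ : Fin L → Equiv.Perm A,
        (∀ i : Fin L, (κ i)⁻¹ * Subst.column ϱ hbij i * κ i = Subst.column ϱ hbij i.rev) ∧
        (⋂ i : Fin L, {τ : Equiv.Perm A |
          ∃ γ ∈ Subgroup.centralizer {Subst.column ϱ hbij i}, τ = γ * κ i}).Nonempty ∧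
        π ∈ ⋂ i : Fin L, {τ : Equiv.Perm A |
          ∃ γ ∈ Subgroup.centralizer {Subst.column ϱ hbij i}, τ = γ * κ i}] := by
  tfae_have 1 → 2 := by
    rintro ⟨f, -, -, hf | hf⟩
    · refine Subst.conj_column_of_reflection hL haper hprim hbij hid π 0 fun x hx => ?_
      have h : (fun n => π (x (0 - n))) = (f ⟨x, hx⟩).1 := by
        funext n
        rw [hf, zero_sub]
      exact h ▸ (f ⟨x, hx⟩).2
    · refine Subst.conj_column_of_reflection hL haper hprim hbij hid π 1 fun x hx => ?_
      have h : (fun n => π (x (1 - n))) = (f ⟨x, hx⟩).1 := by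
        funext n
        rw [hf]
      exact h ▸ (f ⟨x, hx⟩).2
  tfae_have 2 → 1 := fun h =>
    let ⟨f, hf, hf', hfx⟩ := Subst.exists_reflection hL ϱ haper hprim hbij π h
    ⟨f, hf, hf', Or.inl hfx⟩
  tfae_have 2 → 3 := by
    intro h
    have hmem : π ∈ ⋂ i : Fin L, {τ : Equiv.Perm A |
        ∃ γ ∈ Subgroup.centralizer {Subst.column ϱ hbij i}, τ = γ * π} :=
      Set.mem_iInter.2 fun i => ⟨1, one_mem _, (one_mul π).symm⟩
    -- `π` itself serves as every coset representative.
    exact ⟨fun _ => π, h, ⟨π, hmem⟩, hmem⟩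
  tfae_have 3 → 2 := by
    rintro ⟨κ, hκ, -, hπ⟩ i
    obtain ⟨γ, hγ, hγκ⟩ := Set.mem_iInter.1 hπ i
    rw [hγκ, conj_eq_of_commute_mul (Subgroup.mem_centralizer_iff.1 hγ _ rfl), hκ]
  tfae_finish
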